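/- Let $G$ be a real Lie group. Its tangent bundle $TG$ is a group, with product the tangent map of the multiplication $G\times G\to G$ read on $TG\times TG\cong T(G\times G)$. For a finite-dimensional real vector space $V$, the tangent bundle $TV$ is a real vector space of dimension $2\dim V$ with the sum $X\oplus Y=(T\tau_y)X+(T\tau_x)Y$ for $X\in T_xV$, $Y\in T_yV$ and the scalar multiplication $\lambda\bullet X=(T\sigma_\lambda)X$, where $\tau_a$ is the translation by $a$ and $\sigma_\lambda$ the multiplication by $\lambda$. For a basis $\alpha_1,\dots,\alpha_n$ of $V$ with coordinate functions $x_1,\dots,x_n$, let $\psi:TV\to V\times\mathbb R^n$ be the linear isomorphism $\sum_i v_i\,\partial/\partial x_i|_p\mapsto(p,(v_1,\dots,v_n))$, and consider the basis $\psi^{-1}(\alpha_1,0),\dots,\psi^{-1}(\alpha_n,0),\psi^{-1}(0,e_1),\dots,\psi^{-1}(0,e_n)$ of $TV$. Let $Z:\mathrm{Aut}(V)\to GL(n,\mathbb R)$ and $\breve Z:\mathrm{Aut}(TV)\to GL(2n,\mathbb R)$ be the isomorphisms that take an automorphism to its matrix in these bases, and let $$J_n:T\,GL(n,\mathbb R)\to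 GL(2n,\mathbb R),\qquad J_n(Y)=\begin{pmatrix}a&0\\ Ba&a\end{pmatrix}\quad\text{for } Y\in T_aGL(n,\mathbb R),\ B=(TR_{a^{-1}})Y\in \mathrm{Lie}(GL(n,\mathbb R)),$$ where $R_c(y)=yc$. The prolongation of a finite-dimensional real representation $\Phi:G\to\mathrm{Aut}(V)$ (a smooth group homomorphism) is the group homomorphism $$\widetilde\Phi=\breve Z^{-1}\circ J_n\circ TZ\circ T\Phi:\ TG\to\mathrm{Aut}(TV).$$ Let $\Phi_1:G\to\mathrm{Aut}(V_1)$ and $\Phi_2:G\to\mathrm{Aut}(V_2)$ be finite-dimensional real representations of $G$. Then, under the linear isomorphism $(T\mathrm{pr}_1,T\mathrm{pr}_2):T(V_1\oplus V_2)\to TV_1\oplus TV_2$, $$\widetilde{\Phi_1\oplus\Phi_2}=\widetilde{\Phi_1}\oplus\widetilde{\Phi_2}$$ as homomorphisms $TG\to\mathrm{Aut}(TV_1\oplus TV_2)$, for every choice of the bases of $V_1$, $V_2$ and $V_1\oplus V_2$ used to define the three prolongations. -/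

import Mathlib

open scoped Manifold ContDiff

noncomputable section

namespace LieProlongation

/-! ### The tangent group `TG` of a Lie group `G` -/

section TangentGroup

variable {E : Type*} [NormedAddCommGroup E] [NormedSpace ℝ E] {H : Type*} [TopologicalSpace H]
  {I : ModelWithCorners ℝ E H} {G : Type*} [TopologicalSpace G] [ChartedSpace H G] [Group G]

/-- The product on `TG`: the tangent map of `G × G → G`, read on `TG × TG = T(G × G)`. -/
instance tangentMul : Mul (TangentBundle I G) where
  mul X Y := tangentMap (I.prod I) I (fun p : G × G => p.1 * p.2)
    ((equivTangentBundleProd I G I G).symm (X, Y))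

/-- The unit of `TG`: the zero vector at the unit of `G`. -/
instance tangentOne : One (TangentBundle I G) where
  one := ⟨1, (0 : TangentSpace I (1 : G))⟩

/-- The inverse on `TG`: the tangent map of the inverse of `G`. -/
instance tangentInv : Inv (TangentBundle I G) where
  inv X := tangentMap I I (fun a : G => a⁻¹) X

variable {E' : Type*} [NormedAddCommGroup E'] [NormedSpace ℝ E'] {H' : Type*} [TopologicalSpace H']
  {I' : ModelWithCorners ℝ E' H'} {M : Type*} [TopologicalSpace M] [ChartedSpace H' M]

theorem tangentMap_const_one (p : TangentBundle I' M) :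
    tangentMap I' I (fun _ : M => (1 : G)) p = 1 := by
  simp only [tangentMap, mfderiv_const]
  rfl

variable [LieGroup I ∞ G]

/-- The tangent map of a pointwise product is the product in `TG` of the tangent maps. -/
theorem tangentMap_mul {f g : M → G} {p : TangentBundle I' M}
    (hf : MDifferentiableAt I' I f p.1) (hg : MDifferentiableAt I' I g p.1) :
    tangentMap I' I (fun x => f x * g x) p = tangentMap I' I f p * tangentMap I' I g p := by
  have hm : MDifferentiableAt (I.prod I) I (fun q : G × G => q.1 * q.2) (f p.1, g p.1) :=
    ((contMDiff_mul I ∞ (G := G)).mdifferentiable (by simp)) _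
  have h := tangentMap_comp_at (I := I') (I' := I.prod I) (I'' := I)
    (g := fun q : G × G => q.1 * q.2) (f := fun x => (f x, g x)) p hm (hf.prodMk hg)
  refine h.trans ?_
  change _ = tangentMap (I.prod I) I (fun p : G × G => p.1 * p.2)
    ((equivTangentBundleProd I G I G).symm (tangentMap I' I f p, tangentMap I' I g p))
  congr 1
  simp only [tangentMap, mfderiv_prodMk hf hg]
  rfl

/-- `T` of the first projection, on a pair of tangent vectors. -/
theorem tangentMap_fst_pair {N : Type*} [TopologicalSpace N] [ChartedSpace H N]
    (X : TangentBundle I' M) (Y : TangentBundle I N) :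
    tangentMap (I'.prod I) I' Prod.fst ((equivTangentBundleProd I' M I N).symm (X, Y)) = X := by
  rw [tangentMap_prodFst]; rfl

/-- `T` of the second projection, on a pair of tangent vectors. -/
theorem tangentMap_snd_pair {N : Type*} [TopologicalSpace N] [ChartedSpace H N]
    (X : TangentBundle I' M) (Y : TangentBundle I N) :
    tangentMap (I'.prod I) I Prod.snd ((equivTangentBundleProd I' M I N).symm (X, Y)) = Y := by
  rw [tangentMap_prodSnd]; rfl

/-- The tangent bundle of a Lie group is a group. -/
instance tangentGroup : Group (TangentBundle I G) where
  mul_assoc X Y Z := by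
    let q := (equivTangentBundleProd I G I G).symm (Y, Z)
    let p := (equivTangentBundleProd I G (I.prod I) (G × G)).symm (X, q)
    have d1 : MDifferentiableAt (I.prod (I.prod I)) I (Prod.fst : G × (G × G) → G) p.1 :=
      mdifferentiableAt_fst
    have d2 : MDifferentiableAt (I.prod (I.prod I)) (I.prod I)
        (Prod.snd : G × (G × G) → G × G) p.1 := mdifferentiableAt_snd
    have d21 : MDifferentiableAt (I.prod (I.prod I)) I
        (fun x : G × (G × G) => x.2.1) p.1 := mdifferentiableAt_fst.comp _ d2
    have d22 : MDifferentiableAt (I.prod (I.prod I)) I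
        (fun x : G × (G × G) => x.2.2) p.1 := mdifferentiableAt_snd.comp _ d2
    have hq : tangentMap (I.prod (I.prod I)) (I.prod I) (Prod.snd : G × (G × G) → G × G) p = q :=
      tangentMap_snd_pair X q
    have e1 : tangentMap (I.prod (I.prod I)) I (Prod.fst : G × (G × G) → G) p = X :=
      tangentMap_fst_pair X q
    have e2 : tangentMap (I.prod (I.prod I)) I (fun x : G × (G × G) => x.2.1) p = Y := by
      have := tangentMap_comp_at (I := I.prod (I.prod I)) (I' := I.prod I) (I'' := I)
        (g := (Prod.fst : G × G → G)) (f := (Prod.snd : G × (G × G) → G × G)) p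
        mdifferentiableAt_fst d2
      refine this.trans ?_
      rw [hq]; exact tangentMap_fst_pair Y Z
    have e3 : tangentMap (I.prod (I.prod I)) I (fun x : G × (G × G) => x.2.2) p = Z := by
      have := tangentMap_comp_at (I := I.prod (I.prod I)) (I' := I.prod I) (I'' := I)
        (g := (Prod.snd : G × G → G)) (f := (Prod.snd : G × (G × G) → G × G)) p
        mdifferentiableAt_snd d2
      refine this.trans ?_
      rw [hq]; exact tangentMap_snd_pair Y Z
    have hm : MDifferentiable (I.prod I) I (fun q : G × G => q.1 * q.2) :=
      (contMDiff_mul I ∞ (G := G)).mdifferentiable (by simp)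
    have d12 : MDifferentiableAt (I.prod (I.prod I)) I
        (fun x : G × (G × G) => x.1 * x.2.1) p.1 :=
      (hm _).comp p.1 (d1.prodMk d21)
    have d23 : MDifferentiableAt (I.prod (I.prod I)) I
        (fun x : G × (G × G) => x.2.1 * x.2.2) p.1 :=
      (hm _).comp p.1 (d21.prodMk d22)
    have l := tangentMap_mul d12 d22
    have r := tangentMap_mul d1 d23
    rw [tangentMap_mul d1 d21, e1, e2, e3] at l
    rw [tangentMap_mul d21 d22, e1, e2, e3] at r
    rw [← l, ← r]
    simp only [mul_assoc]
  one_mul X := by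
    have h := tangentMap_mul (I := I) (I' := I) (f := fun _ : G => (1 : G)) (g := id) (p := X)
      mdifferentiableAt_const mdifferentiableAt_id
    rw [tangentMap_const_one, tangentMap_id] at h
    refine h.symm.trans ?_
    have : (fun x : G => 1 * id x) = id := by ext x; simp
    rw [this, tangentMap_id]; rfl
  mul_one X := by
    have h := tangentMap_mul (I := I) (I' := I) (f := id) (g := fun _ : G => (1 : G)) (p := X)
      mdifferentiableAt_id mdifferentiableAt_const
    rw [tangentMap_const_one, tangentMap_id] at h
    refine h.symm.trans ?_
    have : (fun x : G => id x * 1) = id := by ext x; simp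
    rw [this, tangentMap_id]; rfl
  inv_mul_cancel X := by
    have hi : MDifferentiableAt I I (fun a : G => a⁻¹) X.1 :=
      (contMDiff_inv I ∞ (G := G)).mdifferentiable (by simp) _
    have h := tangentMap_mul (I := I) (I' := I) (g := id) (p := X) hi mdifferentiableAt_id
    rw [tangentMap_id] at h
    refine h.symm.trans ?_
    have : (fun x : G => x⁻¹ * id x) = fun _ => 1 := by ext x; simp
    rw [this, tangentMap_const_one]

variable {G' : Type*} [TopologicalSpace G'] [ChartedSpace H' G'] [Group G'] [LieGroup I' ∞ G']

/-- The tangent map `Tγ : TG → TG'` of a homomorphism of Lie groups, as a group homomorphism. -/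
def tangentHom (γ : ContMDiffMonoidMorphism I I' ∞ G G') :
    TangentBundle I G →* TangentBundle I' G' :=
  MonoidHom.mk' (tangentMap I I' γ) (by
    intro X Y
    let q := (equivTangentBundleProd I G I G).symm (X, Y)
    have hγ : MDifferentiable I I' γ := γ.contMDiff_toFun.mdifferentiable (by simp)
    have hm : MDifferentiable (I.prod I) I (fun q : G × G => q.1 * q.2) :=
      (contMDiff_mul I ∞ (G := G)).mdifferentiable (by simp)
    have h1 := tangentMap_comp_at (I := I.prod I) (I' := I) (I'' := I') (g := γ)
      (f := (Prod.fst : G × G → G)) q (hγ _) mdifferentiableAt_fst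
    have h2 := tangentMap_comp_at (I := I.prod I) (I' := I) (I'' := I') (g := γ)
      (f := (Prod.snd : G × G → G)) q (hγ _) mdifferentiableAt_snd
    have h3 := tangentMap_comp_at (I := I.prod I) (I' := I) (I'' := I') (g := γ)
      (f := fun q : G × G => q.1 * q.2) q (hγ _) (hm _)
    rw [tangentMap_fst_pair] at h1
    rw [tangentMap_snd_pair] at h2
    refine h3.symm.trans ?_
    rw [← h1, ← h2, ← tangentMap_mul ((hγ _).comp _ mdifferentiableAt_fst)
      ((hγ _).comp _ mdifferentiableAt_snd)]
    congr 1
    ext x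
    exact map_mul γ x.1 x.2)

end TangentGroup

/-! ### The vector space `TV` of a finite-dimensional vector space `V` -/

section TangentVector

variable {V : Type*} [NormedAddCommGroup V] [NormedSpace ℝ V]

/-- `X ⊕ Y = (T τ_y) X + (T τ_x) Y` for `X ∈ T_x V` and `Y ∈ T_y V`, where `τ_a` is the translation
by `a`. -/
instance tangentAdd : Add (TangentBundle 𝓘(ℝ, V) V) where
  add X Y := ⟨X.1 + Y.1,
    (show TangentSpace 𝓘(ℝ, V) (X.1 + Y.1) from
      mfderiv 𝓘(ℝ, V) 𝓘(ℝ, V) (fun z : V => z + Y.1) X.1 X.2) +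
    (show TangentSpace 𝓘(ℝ, V) (X.1 + Y.1) from
      mfderiv 𝓘(ℝ, V) 𝓘(ℝ, V) (fun z : V => X.1 + z) Y.1 Y.2)⟩

/-- `c • X = (T σ_c) X`, where `σ_c` is the multiplication by `c`. -/
instance tangentSMul : SMul ℝ (TangentBundle 𝓘(ℝ, V) V) where
  smul c X := tangentMap 𝓘(ℝ, V) 𝓘(ℝ, V) (fun z : V => c • z) X

instance tangentZero : Zero (TangentBundle 𝓘(ℝ, V) V) where
  zero := ⟨0, (0 : TangentSpace 𝓘(ℝ, V) (0 : V))⟩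

instance tangentNeg : Neg (TangentBundle 𝓘(ℝ, V) V) where
  neg X := tangentMap 𝓘(ℝ, V) 𝓘(ℝ, V) (fun z : V => -z) X

/-- The pair of base point and velocity of a tangent vector of `V`. -/
def pair (X : TangentBundle 𝓘(ℝ, V) V) : V × V := (X.1, X.2)

theorem pair_injective : Function.Injective (pair (V := V)) := by
  rintro ⟨x, u⟩ ⟨y, v⟩ h
  obtain ⟨h1, h2⟩ := Prod.mk.inj h
  dsimp only at h1 h2
  subst h1
  congr 1

theorem mfderiv_vec {W : Type*} [NormedAddCommGroup W] [NormedSpace ℝ W] {f : V → W}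
    {L : V →L[ℝ] W} {p : V} (h : HasFDerivAt f L p) (v : V) :
    @Eq W (mfderiv 𝓘(ℝ, V) 𝓘(ℝ, W) f p v) (L v) := by
  rw [mfderiv_eq_fderiv, h.fderiv]
  rfl

theorem pair_add (X Y : TangentBundle 𝓘(ℝ, V) V) : pair (X + Y) = pair X + pair Y :=
  Prod.ext rfl (congrArg₂ (fun a b : V => a + b)
    (mfderiv_vec ((hasFDerivAt_id X.1).add_const Y.1) X.2)
    (mfderiv_vec ((hasFDerivAt_id Y.1).const_add X.1) Y.2))

theorem pair_smul (c : ℝ) (X : TangentBundle 𝓘(ℝ, V) V) : pair (c • X) = c • pair X :=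
  Prod.ext rfl (mfderiv_vec ((hasFDerivAt_id X.1).const_smul c) X.2)

theorem pair_neg (X : TangentBundle 𝓘(ℝ, V) V) : pair (-X) = -pair X :=
  Prod.ext rfl (mfderiv_vec (hasFDerivAt_id X.1).neg X.2)

theorem pair_zero : pair (0 : TangentBundle 𝓘(ℝ, V) V) = 0 := rfl

instance tangentAddCommGroup : AddCommGroup (TangentBundle 𝓘(ℝ, V) V) where
  add_assoc X Y Z := pair_injective (by simp only [pair_add, add_assoc])
  zero_add X := pair_injective (by simp only [pair_add, pair_zero, zero_add])
  add_zero X := pair_injective (by simp only [pair_add, pair_zero, add_zero])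
  nsmul := nsmulRec
  zsmul := zsmulRec
  neg_add_cancel X := pair_injective (by simp only [pair_add, pair_neg, pair_zero, neg_add_cancel])
  add_comm X Y := pair_injective (by simp only [pair_add, add_comm])

instance tangentModule : Module ℝ (TangentBundle 𝓘(ℝ, V) V) where
  one_smul X := pair_injective (by simp only [pair_smul, one_smul])
  mul_smul a b X := pair_injective (by simp only [pair_smul, mul_smul])
  smul_zero a := pair_injective (by simp only [pair_smul, pair_zero, smul_zero])
  smul_add a X Y := pair_injective (by simp only [pair_smul, pair_add, smul_add])
  add_smul a b X := pair_injective (by simp only [pair_smul, pair_add, add_smul])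
  zero_smul X := pair_injective (by simp only [pair_smul, pair_zero, zero_smul])

variable [FiniteDimensional ℝ V] {ι : Type*}

theorem mfderiv_coord (b : Module.Basis ι ℝ V) (i : ι) (p v : V) :
    @Eq ℝ (mfderiv 𝓘(ℝ, V) 𝓘(ℝ, ℝ) (fun z : V => b.repr z i) p v) (b.repr v i) :=
  mfderiv_vec (LinearMap.toContinuousLinearMap (b.coord i)).hasFDerivAt v

variable [Fintype ι]

/-- The bundle trivialization `ψ : TV → V × ℝⁿ` in the global coordinates `x_i` of a basis:
a tangent vector `∑ v_i ∂/∂x_i` at `p` goes to `(p, (v_i))`, where `v_i = dx_i(v)`. -/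
def trivialization (b : Module.Basis ι ℝ V) :
    TangentBundle 𝓘(ℝ, V) V ≃ₗ[ℝ] V × (ι → ℝ) where
  toFun X := (X.1, fun i => mfderiv 𝓘(ℝ, V) 𝓘(ℝ, ℝ) (fun z : V => b.repr z i) X.1 X.2)
  invFun q := ⟨q.1, (∑ i, q.2 i • b i : V)⟩
  map_add' X Y := by
    refine Prod.ext rfl (funext fun i => (mfderiv_coord b i (X + Y).1 (X + Y).2).trans ?_)
    refine Eq.trans ?_ (congrArg₂ (fun a b : ℝ => a + b)
      (mfderiv_coord b i X.1 X.2) (mfderiv_coord b i Y.1 Y.2)).symm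
    change b.repr (pair (X + Y)).2 i = b.repr (pair X).2 i + b.repr (pair Y).2 i
    rw [pair_add]; simp
  map_smul' c X := by
    refine Prod.ext rfl (funext fun i => (mfderiv_coord b i (c • X).1 (c • X).2).trans ?_)
    refine Eq.trans ?_ (congrArg (fun a : ℝ => c * a) (mfderiv_coord b i X.1 X.2)).symm
    change b.repr (pair (c • X)).2 i = c * b.repr (pair X).2 i
    rw [pair_smul]; simp
  left_inv X := by
    refine pair_injective (Prod.ext rfl ?_)
    refine Eq.trans (Finset.sum_congr rfl fun i _ =>
      congrArg (fun a : ℝ => a • b i) (mfderiv_coord b i X.1 X.2)) ?_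
    exact b.sum_repr _
  right_inv q := by
    refine Prod.ext rfl (funext fun i => (mfderiv_coord b i q.1 (∑ i, q.2 i • b i)).trans ?_)
    exact congrFun (b.repr_sum_self q.2) i

/-- The basis `α̃_i = ψ⁻¹(α_i, 0)`, `ỹ_i = ψ⁻¹(0, e_i)` of `TV`. -/
def tangentBasis (b : Module.Basis ι ℝ V) : Module.Basis (ι ⊕ ι) ℝ (TangentBundle 𝓘(ℝ, V) V) :=
  (b.prod (Pi.basisFun ℝ ι)).map (trivialization b).symm

end TangentVector

/-! ### The identification `T(V₁ ⊕ V₂) = TV₁ ⊕ TV₂` -/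

section TangentProd

variable {V₁ : Type*} [NormedAddCommGroup V₁] [NormedSpace ℝ V₁]
  {V₂ : Type*} [NormedAddCommGroup V₂] [NormedSpace ℝ V₂]

/-- The linear isomorphism `T(V₁ ⊕ V₂) → TV₁ ⊕ TV₂` given by the tangent maps of the projections.
Its inverse takes `X ∈ T_x V₁`, `Y ∈ T_y V₂` to `(T f_x) Y + (T f̄_y) X`, where `f_x z = (x, z)` and
`f̄_y z = (z, y)`. -/
def tangentProdEquiv : TangentBundle 𝓘(ℝ, V₁ × V₂) (V₁ × V₂) ≃ₗ[ℝ]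
    TangentBundle 𝓘(ℝ, V₁) V₁ × TangentBundle 𝓘(ℝ, V₂) V₂ where
  toFun W := (tangentMap 𝓘(ℝ, V₁ × V₂) 𝓘(ℝ, V₁) Prod.fst W,
    tangentMap 𝓘(ℝ, V₁ × V₂) 𝓘(ℝ, V₂) Prod.snd W)
  invFun q := ⟨(q.1.1, q.2.1),
    (show TangentSpace 𝓘(ℝ, V₁ × V₂) (q.1.1, q.2.1) from
      mfderiv 𝓘(ℝ, V₂) 𝓘(ℝ, V₁ × V₂) (fun z : V₂ => (q.1.1, z)) q.2.1 q.2.2) +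
    (show TangentSpace 𝓘(ℝ, V₁ × V₂) (q.1.1, q.2.1) from
      mfderiv 𝓘(ℝ, V₁) 𝓘(ℝ, V₁ × V₂) (fun z : V₁ => (z, q.2.1)) q.1.1 q.1.2)⟩
  map_add' W W' := by
    have h := congrArg Prod.snd (pair_add W W')
    refine Prod.ext (pair_injective (Eq.trans ?_ (pair_add _ _).symm))
      (pair_injective (Eq.trans ?_ (pair_add _ _).symm))
    · refine Prod.ext rfl ?_
      simp only [pair, tangentMap, mfderiv_eq_fderiv, fderiv_fst]
      exact congrArg Prod.fst h
    · refine Prod.ext rfl ?_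
      simp only [pair, tangentMap, mfderiv_eq_fderiv, fderiv_snd]
      exact congrArg Prod.snd h
  map_smul' c W := by
    have h := congrArg Prod.snd (pair_smul c W)
    refine Prod.ext (pair_injective (Eq.trans ?_ (pair_smul _ _).symm))
      (pair_injective (Eq.trans ?_ (pair_smul _ _).symm))
    · refine Prod.ext rfl ?_
      simp only [pair, tangentMap, mfderiv_eq_fderiv, fderiv_fst]
      exact congrArg Prod.fst h
    · refine Prod.ext rfl ?_
      simp only [pair, tangentMap, mfderiv_eq_fderiv, fderiv_snd]
      exact congrArg Prod.snd h
  left_inv W := by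
    refine pair_injective (Prod.ext rfl ?_)
    simp only [pair, tangentMap, mfderiv_eq_fderiv, fderiv_fst, fderiv_snd]
    rw [(hasFDerivAt_prodMk_left _ _).fderiv, (hasFDerivAt_prodMk_right _ _).fderiv]
    refine Prod.ext ?_ ?_
    · exact zero_add _
    · exact add_zero _
  right_inv q := by
    refine Prod.ext (pair_injective (Prod.ext rfl ?_)) (pair_injective (Prod.ext rfl ?_))
    · simp only [pair, tangentMap, mfderiv_eq_fderiv, fderiv_fst]
      rw [(hasFDerivAt_prodMk_left _ _).fderiv, (hasFDerivAt_prodMk_right _ _).fderiv]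
      exact zero_add _
    · simp only [pair, tangentMap, mfderiv_eq_fderiv, fderiv_snd]
      rw [(hasFDerivAt_prodMk_left _ _).fderiv, (hasFDerivAt_prodMk_right _ _).fderiv]
      exact add_zero _

end TangentProd

/-! ### The homomorphism `J_n : T GL(n, ℝ) → GL(2n, ℝ)` -/

section UnitsOfAlgebra

variable {R : Type*} [NormedRing R] [NormedAlgebra ℝ R] [CompleteSpace R]

/-- The element of the algebra `R` which a tangent vector of the open subset `Rˣ` of `R` is: its
image under the tangent map of the inclusion of `Rˣ` in `R`. -/
def velocity (Y : TangentBundle 𝓘(ℝ, R) Rˣ) : R :=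
  (tangentMap 𝓘(ℝ, R) 𝓘(ℝ, R) (Units.val : Rˣ → R) Y).2

theorem mdifferentiable_val : MDifferentiable 𝓘(ℝ, R) 𝓘(ℝ, R) (Units.val : Rˣ → R) :=
  (Units.contMDiff_val (n := ∞)).mdifferentiable (by simp)

theorem velocity_mul (X Y : TangentBundle 𝓘(ℝ, R) Rˣ) :
    velocity (X * Y) = velocity X * (Y.1 : R) + (X.1 : R) * velocity Y := by
  let q := (equivTangentBundleProd 𝓘(ℝ, R) Rˣ 𝓘(ℝ, R) Rˣ).symm (X, Y)
  have hm : MDifferentiable (𝓘(ℝ, R).prod 𝓘(ℝ, R)) 𝓘(ℝ, R) (fun q : Rˣ × Rˣ => q.1 * q.2) :=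
    (contMDiff_mul 𝓘(ℝ, R) ∞ (G := Rˣ)).mdifferentiable (by simp)
  have h1 : HasMFDerivAt (𝓘(ℝ, R).prod 𝓘(ℝ, R)) 𝓘(ℝ, R) (fun q : Rˣ × Rˣ => (q.1 : R)) q.1
      ((mfderiv 𝓘(ℝ, R) 𝓘(ℝ, R) (Units.val : Rˣ → R) X.1).comp
        (ContinuousLinearMap.fst ℝ R R)) :=
    HasMFDerivAt.comp (g := (Units.val : Rˣ → R)) q.1 (mdifferentiable_val X.1).hasMFDerivAt
      (hasMFDerivAt_fst q.1)
  have h2 : HasMFDerivAt (𝓘(ℝ, R).prod 𝓘(ℝ, R)) 𝓘(ℝ, R) (fun q : Rˣ × Rˣ => (q.2 : R)) q.1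
      ((mfderiv 𝓘(ℝ, R) 𝓘(ℝ, R) (Units.val : Rˣ → R) Y.1).comp
        (ContinuousLinearMap.snd ℝ R R)) :=
    HasMFDerivAt.comp (g := (Units.val : Rˣ → R)) q.1 (mdifferentiable_val Y.1).hasMFDerivAt
      (hasMFDerivAt_snd q.1)
  have h3 := (h1.mul' h2).mfderiv
  have h4 := tangentMap_comp_at (I := 𝓘(ℝ, R).prod 𝓘(ℝ, R)) (I' := 𝓘(ℝ, R)) (I'' := 𝓘(ℝ, R))
    (g := (Units.val : Rˣ → R)) (f := fun q : Rˣ × Rˣ => q.1 * q.2) q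
    (mdifferentiable_val _) (hm _)
  change (tangentMap 𝓘(ℝ, R) 𝓘(ℝ, R) (Units.val : Rˣ → R)
    (tangentMap (𝓘(ℝ, R).prod 𝓘(ℝ, R)) 𝓘(ℝ, R) (fun q : Rˣ × Rˣ => q.1 * q.2) q)).2 = _
  rw [← h4]
  refine (congrArg (fun L => L q.2) h3).trans ?_
  exact add_comm _ _

theorem velocity_rightTranslation (a : Rˣ) (Y : TangentBundle 𝓘(ℝ, R) Rˣ) :
    velocity (tangentMap 𝓘(ℝ, R) 𝓘(ℝ, R) (fun y : Rˣ => y * a) Y) = velocity Y * (a : R) := by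
  have h := tangentMap_mul (I := 𝓘(ℝ, R)) (I' := 𝓘(ℝ, R)) (f := (id : Rˣ → Rˣ))
    (g := fun _ : Rˣ => a) (p := Y) mdifferentiableAt_id mdifferentiableAt_const
  refine (congrArg velocity h).trans ?_
  rw [velocity_mul, tangentMap_id]
  have h0 : velocity (tangentMap 𝓘(ℝ, R) 𝓘(ℝ, R) (fun _ : Rˣ => a) Y) = 0 := by
    simp only [velocity, tangentMap, mfderiv_const]
    exact map_zero _
  rw [h0, mul_zero, add_zero]
  rfl

end UnitsOfAlgebra

section GeneralLinear

open scoped Matrix.Norms.Operator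

-- The topology of the space of matrices is read off its norm.
attribute [-instance] instTopologicalSpaceMatrix
attribute [-instance] Matrix.instUniformSpace

variable {ι : Type*} [Fintype ι] [DecidableEq ι]

instance completeSpace_matrix : CompleteSpace (Matrix ι ι ℝ) :=
  FiniteDimensional.complete ℝ (Matrix ι ι ℝ)

/-- The tangent bundle of `GL(n, ℝ)`. -/
abbrev TangentGL (ι : Type*) [Fintype ι] [DecidableEq ι] : Type _ :=
  TangentBundle 𝓘(ℝ, Matrix ι ι ℝ) (Matrix ι ι ℝ)ˣ

/-- The matrix `B = (T R_{a⁻¹}) Y` in the Lie algebra of `GL(n, ℝ)`, for `Y ∈ T_a GL(n, ℝ)`. -/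
def rightLog (Y : TangentGL ι) : Matrix ι ι ℝ :=
  velocity (tangentMap 𝓘(ℝ, Matrix ι ι ℝ) 𝓘(ℝ, Matrix ι ι ℝ)
    (fun y : (Matrix ι ι ℝ)ˣ => y * (Y.1)⁻¹) Y)

theorem rightLog_mul (Y : TangentGL ι) : rightLog Y * (Y.1 : Matrix ι ι ℝ) = velocity Y := by
  rw [rightLog, velocity_rightTranslation, mul_assoc, Units.inv_mul, mul_one]

/-- The block matrix with rows `(a, 0)` and `(B a, a)`, for `Y = [a, B]`. -/
def jMatrix (Y : TangentGL ι) : Matrix (ι ⊕ ι) (ι ⊕ ι) ℝ :=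
  Matrix.fromBlocks (Y.1 : Matrix ι ι ℝ) 0 (rightLog Y * (Y.1 : Matrix ι ι ℝ))
    (Y.1 : Matrix ι ι ℝ)

/-- The homomorphism `J_n : T GL(n, ℝ) → GL(2n, ℝ)`. -/
def jHom : TangentGL ι →* (Matrix (ι ⊕ ι) (ι ⊕ ι) ℝ)ˣ :=
  MonoidHom.toHomUnits
    { toFun := jMatrix
      map_one' := by
        have h : velocity (1 : TangentGL ι) = 0 := map_zero _
        rw [jMatrix, rightLog_mul, h]
        exact Matrix.fromBlocks_one
      map_mul' := fun X Y => by
        rw [jMatrix, jMatrix, jMatrix, rightLog_mul, rightLog_mul, rightLog_mul, velocity_mul,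
          Matrix.fromBlocks_multiply]
        simp only [zero_mul, mul_zero, add_zero, zero_add]
        rfl }

end GeneralLinear

/-! ### Representations and their prolongations -/

section Prolongation

variable {E : Type*} [NormedAddCommGroup E] [NormedSpace ℝ E] {H : Type*} [TopologicalSpace H]
  {I : ModelWithCorners ℝ E H} {G : Type*} [TopologicalSpace G] [ChartedSpace H G] [Group G]
  {V : Type*} [NormedAddCommGroup V] [NormedSpace ℝ V] [FiniteDimensional ℝ V]

instance completeSpace_endomorphisms : CompleteSpace (V →L[ℝ] V) :=
  FiniteDimensional.complete ℝ (V →L[ℝ] V)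

/-- A finite-dimensional real representation of the Lie group `G`: a homomorphism of Lie groups
(smooth homomorphism of groups) `G → Aut(V)`, where `Aut(V)` is the Lie group of the invertible
elements of the algebra of endomorphisms of `V`. -/
abbrev LieRep (I : ModelWithCorners ℝ E H) (G : Type*) [TopologicalSpace G] [ChartedSpace H G]
    [Group G] (V : Type*) [NormedAddCommGroup V] [NormedSpace ℝ V] [FiniteDimensional ℝ V] :
    Type _ :=
  ContMDiffMonoidMorphism I 𝓘(ℝ, V →L[ℝ] V) ∞ G (V →L[ℝ] V)ˣ

section Coordinates

open scoped Matrix.Norms.Operator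

-- The topology of the space of matrices is read off its norm.
attribute [-instance] instTopologicalSpaceMatrix
attribute [-instance] Matrix.instUniformSpace

variable {ι : Type*} [Fintype ι] [DecidableEq ι]

/-- The matrix of an endomorphism of `V` with respect to a basis, as a homomorphism of algebras. -/
def matrixHom (b : Module.Basis ι ℝ V) : (V →L[ℝ] V) →ₐ[ℝ] Matrix ι ι ℝ :=
  AlgHom.ofLinearMap
    ((LinearMap.toMatrixAlgEquiv b).toLinearMap ∘ₗ ContinuousLinearMap.coeLM ℝ)
    (map_one (LinearMap.toMatrixAlgEquiv b))
    (fun F F' => map_mul (LinearMap.toMatrixAlgEquiv b) (F : V →ₗ[ℝ] V) (F' : V →ₗ[ℝ] V))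

/-- The homomorphism of Lie groups `Z : Aut(V) → GL(n, ℝ)`, which takes `F` to its matrix. -/
def zHom (b : Module.Basis ι ℝ V) :
    ContMDiffMonoidMorphism 𝓘(ℝ, V →L[ℝ] V) 𝓘(ℝ, Matrix ι ι ℝ) ∞
      (V →L[ℝ] V)ˣ (Matrix ι ι ℝ)ˣ where
  toMonoidHom := Units.map (matrixHom b : (V →L[ℝ] V) →* Matrix ι ι ℝ)
  contMDiff_toFun := by
    apply ContMDiff.of_comp_isOpenEmbedding Units.isOpenEmbedding_val
    have h : ContDiff ℝ ∞ (matrixHom b) :=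
      (LinearMap.toContinuousLinearMap (matrixHom b).toLinearMap).contDiff
    exact h.contMDiff.comp Units.contMDiff_val

/-- The isomorphism `Z̆ : Aut(TV) → GL(2n, ℝ)`, which takes `F` to its matrix with respect to the
basis `α̃_1, …, α̃_n, ỹ_1, …, ỹ_n` of `TV`. -/
def zTangentEquiv (b : Module.Basis ι ℝ V) :
    LinearMap.GeneralLinearGroup ℝ (TangentBundle 𝓘(ℝ, V) V) ≃* (Matrix (ι ⊕ ι) (ι ⊕ ι) ℝ)ˣ :=
  Units.mapEquiv (LinearMap.toMatrixAlgEquiv (tangentBasis b)).toMulEquiv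

/-- The prolongation `Φ̃ = Z̆⁻¹ ∘ J_n ∘ TZ ∘ TΦ : TG → Aut(TV)` of a representation
`Φ : G → Aut(V)`, where the coordinates are those of the basis `b` of `V`. -/
def prolongation [LieGroup I ∞ G] (b : Module.Basis ι ℝ V) (Φ : LieRep I G V) :
    TangentBundle I G →* LinearMap.GeneralLinearGroup ℝ (TangentBundle 𝓘(ℝ, V) V) :=
  (zTangentEquiv b).symm.toMonoidHom.comp
    (jHom.comp ((tangentHom (zHom b)).comp (tangentHom Φ)))

end Coordinates

/-- The direct sum `ρ₁ ⊕ ρ₂ : K → Aut(W₁ ⊕ W₂)` of linear representations of an abstract group. -/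
def directSum {K W₁ W₂ : Type*} [Group K] [AddCommGroup W₁] [Module ℝ W₁] [AddCommGroup W₂]
    [Module ℝ W₂] (ρ₁ : K →* LinearMap.GeneralLinearGroup ℝ W₁)
    (ρ₂ : K →* LinearMap.GeneralLinearGroup ℝ W₂) :
    K →* LinearMap.GeneralLinearGroup ℝ (W₁ × W₂) :=
  MonoidHom.toHomUnits
    { toFun := fun k => LinearMap.prodMap (ρ₁ k : W₁ →ₗ[ℝ] W₁) (ρ₂ k : W₂ →ₗ[ℝ] W₂)
      map_one' := by rw [map_one, map_one]; rfl
      map_mul' := fun k l => by rw [map_mul, map_mul]; rfl }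

variable {V₁ : Type*} [NormedAddCommGroup V₁] [NormedSpace ℝ V₁] [FiniteDimensional ℝ V₁]
  {V₂ : Type*} [NormedAddCommGroup V₂] [NormedSpace ℝ V₂] [FiniteDimensional ℝ V₂]

/-- The direct sum `Φ₁ ⊕ Φ₂ : G → Aut(V₁ ⊕ V₂)` of representations of a Lie group. -/
def LieRep.directSum (Φ₁ : LieRep I G V₁) (Φ₂ : LieRep I G V₂) : LieRep I G (V₁ × V₂) where
  toMonoidHom := MonoidHom.toHomUnits
    { toFun := fun g =>
        ContinuousLinearMap.prodMap (Φ₁ g : V₁ →L[ℝ] V₁) (Φ₂ g : V₂ →L[ℝ] V₂)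
      map_one' := by rw [map_one, map_one]; rfl
      map_mul' := fun g h => by rw [map_mul, map_mul]; rfl }
  contMDiff_toFun := by
    apply ContMDiff.of_comp_isOpenEmbedding Units.isOpenEmbedding_val
    have h1 : ContMDiff I 𝓘(ℝ, V₁ →L[ℝ] V₁) ∞ (fun g : G => (Φ₁ g : V₁ →L[ℝ] V₁)) :=
      Units.contMDiff_val.comp Φ₁.contMDiff_toFun
    have h2 : ContMDiff I 𝓘(ℝ, V₂ →L[ℝ] V₂) ∞ (fun g : G => (Φ₂ g : V₂ →L[ℝ] V₂)) :=
      Units.contMDiff_val.comp Φ₂.contMDiff_toFun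
    exact (ContinuousLinearMap.prodMapL ℝ V₁ V₁ V₂ V₂).contDiff.contMDiff.comp (h1.prodMk_space h2)

end Prolongation

end LieProlongation

end

/-!
Identify a tangent vector of `V` with its pair (base point, velocity). In these terms the block
matrix `J_n(Y)` is the matrix of `(p, v) ↦ (a p, A p + a v)`, where `a` is the base point and `A`
the velocity of the tangent vector of `Aut(V)` with coordinates `Y`. So the prolongation of `Φ` lets
`X ∈ T_g G` act by `(p, v) ↦ (Φ(g) p, dΦ(X) p + Φ(g) v)`, a formula without reference to the basis.
It respects direct sums because `d(Φ₁ ⊕ Φ₂) = dΦ₁ ⊕ dΦ₂`, the direct sum of endomorphisms being a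
continuous linear operation.
-/

noncomputable section

namespace LieProlongation

section Velocity

variable {E : Type*} [NormedAddCommGroup E] [NormedSpace ℝ E] {H : Type*} [TopologicalSpace H]
  {I : ModelWithCorners ℝ E H} {M : Type*} [TopologicalSpace M] [ChartedSpace H M]

theorem hasMFDerivAt_prodMk_space {F₁ F₂ : Type*} [NormedAddCommGroup F₁] [NormedSpace ℝ F₁]
    [NormedAddCommGroup F₂] [NormedSpace ℝ F₂] {f₁ : M → F₁} {f₂ : M → F₂} {x : M}
    {D₁ : E →L[ℝ] F₁} {D₂ : E →L[ℝ] F₂} (h₁ : HasMFDerivAt I 𝓘(ℝ, F₁) f₁ x D₁)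
    (h₂ : HasMFDerivAt I 𝓘(ℝ, F₂) f₂ x D₂) :
    HasMFDerivAt I 𝓘(ℝ, F₁ × F₂) (fun y => (f₁ y, f₂ y)) x (D₁.prod D₂) :=
  ⟨h₁.1.prodMk h₂.1, h₁.2.prodMk h₂.2⟩

variable {R : Type*} [NormedRing R] [NormedAlgebra ℝ R] [CompleteSpace R]

theorem hasMFDerivAt_val_comp {f : M → Rˣ} {x : M} (hf : MDifferentiableAt I 𝓘(ℝ, R) f x) :
    HasMFDerivAt I 𝓘(ℝ, R) (fun y => (f y : R)) x
      ((mfderiv 𝓘(ℝ, R) 𝓘(ℝ, R) (Units.val : Rˣ → R) (f x)).comp (mfderiv I 𝓘(ℝ, R) f x)) :=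
  (mdifferentiable_val (f x)).hasMFDerivAt.comp x hf.hasMFDerivAt

theorem velocity_tangentMap {f : M → Rˣ} {X : TangentBundle I M} {D : E →L[ℝ] R}
    (hf : MDifferentiableAt I 𝓘(ℝ, R) f X.1)
    (hD : HasMFDerivAt I 𝓘(ℝ, R) (fun y => (f y : R)) X.1 D) :
    velocity (tangentMap I 𝓘(ℝ, R) f X) = D X.2 :=
  congrArg (fun L => L X.2) (hasMFDerivAt_unique (hasMFDerivAt_val_comp hf) hD)

end Velocity

section BlockMatrix

variable {R : Type*} [CommSemiring R] {M₁ M₂ N₁ N₂ : Type*}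
  [AddCommMonoid M₁] [Module R M₁] [AddCommMonoid M₂] [Module R M₂]
  [AddCommMonoid N₁] [Module R N₁] [AddCommMonoid N₂] [Module R N₂]
  {m₁ m₂ n₁ n₂ : Type*} [Fintype m₁] [DecidableEq m₁] [Fintype m₂] [DecidableEq m₂]
  [Finite n₁] [Finite n₂]

theorem toMatrix_prod_coprod (b₁ : Module.Basis m₁ R M₁) (b₂ : Module.Basis m₂ R M₂)
    (c₁ : Module.Basis n₁ R N₁) (c₂ : Module.Basis n₂ R N₂) (f₁₁ : M₁ →ₗ[R] N₁)
    (f₁₂ : M₂ →ₗ[R] N₁) (f₂₁ : M₁ →ₗ[R] N₂) (f₂₂ : M₂ →ₗ[R] N₂) :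
    LinearMap.toMatrix (b₁.prod b₂) (c₁.prod c₂)
        ((f₁₁.coprod f₁₂).prod (f₂₁.coprod f₂₂)) =
      Matrix.fromBlocks (LinearMap.toMatrix b₁ c₁ f₁₁) (LinearMap.toMatrix b₂ c₁ f₁₂)
        (LinearMap.toMatrix b₁ c₂ f₂₁) (LinearMap.toMatrix b₂ c₂ f₂₂) := by
  ext (i | i) (j | j) <;> simp [LinearMap.toMatrix_apply]

end BlockMatrix

section TangentVector

variable {V : Type*} [NormedAddCommGroup V] [NormedSpace ℝ V]

/-- The linear isomorphism `TV ≃ V × V` given by the pair of base point and velocity; unlike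
`trivialization b` it does not depend on a basis. -/
def pairEquiv : TangentBundle 𝓘(ℝ, V) V ≃ₗ[ℝ] V × V where
  toFun := pair
  invFun q := ⟨q.1, q.2⟩
  map_add' := pair_add
  map_smul' := pair_smul
  left_inv _ := rfl
  right_inv _ := rfl

theorem tangentBasis_eq_map_prod [FiniteDimensional ℝ V] {ι : Type*} [Fintype ι]
    (b : Module.Basis ι ℝ V) : tangentBasis b = (b.prod b).map pairEquiv.symm := by
  classical
  have hψ (q : V × (ι → ℝ)) :
      pairEquiv ((trivialization b).symm q) = (q.1, ∑ i, q.2 i • b i) := rfl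
  refine Module.Basis.eq_of_apply_eq fun k => pairEquiv.injective ?_
  rcases k with i | i <;> simp [tangentBasis, hψ, Pi.single_apply]

variable {V₁ : Type*} [NormedAddCommGroup V₁] [NormedSpace ℝ V₁]
  {V₂ : Type*} [NormedAddCommGroup V₂] [NormedSpace ℝ V₂]

theorem pairEquiv_tangentProdEquiv_fst (W : TangentBundle 𝓘(ℝ, V₁ × V₂) (V₁ × V₂)) :
    pairEquiv (tangentProdEquiv W).1 = ((pairEquiv W).1.1, (pairEquiv W).2.1) :=
  Prod.ext rfl (mfderiv_vec (V := V₁ × V₂) hasFDerivAt_fst W.2)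

theorem pairEquiv_tangentProdEquiv_snd (W : TangentBundle 𝓘(ℝ, V₁ × V₂) (V₁ × V₂)) :
    pairEquiv (tangentProdEquiv W).2 = ((pairEquiv W).1.2, (pairEquiv W).2.2) :=
  Prod.ext rfl (mfderiv_vec (V := V₁ × V₂) hasFDerivAt_snd W.2)

end TangentVector

section TangentAction

variable {V : Type*} [NormedAddCommGroup V] [NormedSpace ℝ V] [FiniteDimensional ℝ V]

/-- The action of `T Aut(V)` on `TV = V × V` which is tangent to the action of `Aut(V)` on `V`: a
tangent vector with base point `a` and velocity `A` takes `(p, v)` to `(a p, A p + a v)`. -/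
def tangentAction (Y : TangentBundle 𝓘(ℝ, V →L[ℝ] V) (V →L[ℝ] V)ˣ) : Module.End ℝ (V × V) :=
  letI a : V →ₗ[ℝ] V := (Y.1 : V →L[ℝ] V)
  letI A : V →ₗ[ℝ] V := (velocity Y : V →L[ℝ] V)
  (a.coprod 0).prod (A.coprod a)

theorem tangentAction_apply (Y : TangentBundle 𝓘(ℝ, V →L[ℝ] V) (V →L[ℝ] V)ˣ) (q : V × V) :
    tangentAction Y q =
      ((Y.1 : V →L[ℝ] V) q.1, velocity Y q.1 + (Y.1 : V →L[ℝ] V) q.2) := by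
  simp [tangentAction]

open scoped Matrix.Norms.Operator

-- As in the definition of `zHom`, matrices carry the topology of their norm.
attribute [-instance] instTopologicalSpaceMatrix
attribute [-instance] Matrix.instUniformSpace

variable {ι : Type*} [Fintype ι] [DecidableEq ι]

theorem velocity_tangentHom_zHom (b : Module.Basis ι ℝ V)
    (Y : TangentBundle 𝓘(ℝ, V →L[ℝ] V) (V →L[ℝ] V)ˣ) :
    velocity (tangentHom (zHom b) Y) = matrixHom b (velocity Y) :=
  velocity_tangentMap (f := zHom b) (X := Y)
    ((zHom b).contMDiff_toFun.mdifferentiable (by simp) Y.1)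
    ((LinearMap.toContinuousLinearMap (matrixHom b).toLinearMap).hasMFDerivAt.comp Y.1
      (mdifferentiable_val Y.1).hasMFDerivAt)

theorem jMatrix_tangentHom_zHom (b : Module.Basis ι ℝ V)
    (Y : TangentBundle 𝓘(ℝ, V →L[ℝ] V) (V →L[ℝ] V)ˣ) :
    jMatrix (tangentHom (zHom b) Y) =
      LinearMap.toMatrix (tangentBasis b) (tangentBasis b)
        (pairEquiv.symm.conj (tangentAction Y)) := by
  have hblocks : jMatrix (tangentHom (zHom b) Y) =
      Matrix.fromBlocks (matrixHom b Y.1) 0 (matrixHom b (velocity Y)) (matrixHom b Y.1) := by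
    rw [jMatrix, rightLog_mul, velocity_tangentHom_zHom]
    rfl
  have haction : LinearMap.toMatrix (b.prod b) (b.prod b) (tangentAction Y) =
      Matrix.fromBlocks (matrixHom b Y.1) 0 (matrixHom b (velocity Y)) (matrixHom b Y.1) := by
    rw [tangentAction, toMatrix_prod_coprod, map_zero]
    rfl
  rw [hblocks, ← haction, tangentBasis_eq_map_prod, LinearMap.toMatrix_map_left,
    LinearMap.toMatrix_map_right]
  rfl

end TangentAction

section Prolongation

variable {E : Type*} [NormedAddCommGroup E] [NormedSpace ℝ E] {H : Type*} [TopologicalSpace H]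
  {I : ModelWithCorners ℝ E H} {G : Type*} [TopologicalSpace G] [ChartedSpace H G] [Group G]
  {V : Type*} [NormedAddCommGroup V] [NormedSpace ℝ V] [FiniteDimensional ℝ V]
  {V₁ : Type*} [NormedAddCommGroup V₁] [NormedSpace ℝ V₁] [FiniteDimensional ℝ V₁]
  {V₂ : Type*} [NormedAddCommGroup V₂] [NormedSpace ℝ V₂] [FiniteDimensional ℝ V₂]
  {ι₁ ι₂ ι : Type*} [Fintype ι₁] [DecidableEq ι₁] [Fintype ι₂] [DecidableEq ι₂]
  [Fintype ι] [DecidableEq ι]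

theorem LieRep.mdifferentiable (Φ : LieRep I G V) : MDifferentiable I 𝓘(ℝ, V →L[ℝ] V) Φ :=
  Φ.contMDiff_toFun.mdifferentiable (by simp)

variable [LieGroup I ∞ G]

theorem prolongation_eq_conj_tangentAction (b : Module.Basis ι ℝ V) (Φ : LieRep I G V)
    (X : TangentBundle I G) :
    (prolongation b Φ X : Module.End ℝ (TangentBundle 𝓘(ℝ, V) V)) =
      pairEquiv.symm.conj (tangentAction (tangentHom Φ X)) :=
  (LinearMap.toMatrixAlgEquiv (tangentBasis b)).symm_apply_eq.2
    (jMatrix_tangentHom_zHom b (tangentHom Φ X))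

theorem pairEquiv_prolongation (b : Module.Basis ι ℝ V) (Φ : LieRep I G V)
    (X : TangentBundle I G) (W : TangentBundle 𝓘(ℝ, V) V) :
    pairEquiv ((prolongation b Φ X : Module.End ℝ (TangentBundle 𝓘(ℝ, V) V)) W) =
      tangentAction (tangentHom Φ X) (pairEquiv W) := by
  rw [prolongation_eq_conj_tangentAction]
  rfl

theorem velocity_tangentHom_directSum (Φ₁ : LieRep I G V₁) (Φ₂ : LieRep I G V₂)
    (X : TangentBundle I G) :
    velocity (tangentHom (Φ₁.directSum Φ₂) X) =
      ContinuousLinearMap.prodMap (velocity (tangentHom Φ₁ X)) (velocity (tangentHom Φ₂ X)) := by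
  have h₁ := hasMFDerivAt_val_comp (Φ₁.mdifferentiable X.1)
  have h₂ := hasMFDerivAt_val_comp (Φ₂.mdifferentiable X.1)
  exact velocity_tangentMap ((Φ₁.directSum Φ₂).mdifferentiable X.1)
    ((ContinuousLinearMap.prodMapL ℝ V₁ V₁ V₂ V₂).hasMFDerivAt.comp X.1
      (hasMFDerivAt_prodMk_space h₁ h₂))

theorem tangentAction_directSum (Φ₁ : LieRep I G V₁) (Φ₂ : LieRep I G V₂)
    (X : TangentBundle I G) (q : (V₁ × V₂) × (V₁ × V₂)) :
    LinearEquiv.prodProdProdComm ℝ V₁ V₂ V₁ V₂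
        (tangentAction (tangentHom (Φ₁.directSum Φ₂) X) q) =
      (tangentAction (tangentHom Φ₁ X) (q.1.1, q.2.1),
        tangentAction (tangentHom Φ₂ X) (q.1.2, q.2.2)) := by
  simp only [tangentAction_apply, velocity_tangentHom_directSum]
  rfl

theorem tangentProdEquiv_prolongation (b₁ : Module.Basis ι₁ ℝ V₁) (b₂ : Module.Basis ι₂ ℝ V₂)
    (b : Module.Basis ι ℝ (V₁ × V₂)) (Φ₁ : LieRep I G V₁) (Φ₂ : LieRep I G V₂)
    (X : TangentBundle I G) (W : TangentBundle 𝓘(ℝ, V₁ × V₂) (V₁ × V₂)) :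
    tangentProdEquiv ((prolongation b (Φ₁.directSum Φ₂) X : Module.End ℝ _) W) =
      ((prolongation b₁ Φ₁ X : Module.End ℝ _) (tangentProdEquiv W).1,
        (prolongation b₂ Φ₂ X : Module.End ℝ _) (tangentProdEquiv W).2) := by
  refine Prod.ext (pairEquiv.injective ?_) (pairEquiv.injective ?_)
  · rw [pairEquiv_tangentProdEquiv_fst, pairEquiv_prolongation, pairEquiv_prolongation,
      pairEquiv_tangentProdEquiv_fst]
    exact congrArg Prod.fst (tangentAction_directSum Φ₁ Φ₂ X (pairEquiv W))
  · rw [pairEquiv_tangentProdEquiv_snd, pairEquiv_prolongation, pairEquiv_prolongation,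
      pairEquiv_tangentProdEquiv_snd]
    exact congrArg Prod.snd (tangentAction_directSum Φ₁ Φ₂ X (pairEquiv W))

end Prolongation

end LieProlongation

end

theorem corollary3p11
    {E : Type*} [NormedAddCommGroup E] [NormedSpace ℝ E]
    {H : Type*} [TopologicalSpace H] (I : ModelWithCorners ℝ E H)
    {G : Type*} [TopologicalSpace G] [ChartedSpace H G] [Group G] [LieGroup I ∞ G]
    {V₁ : Type*} [NormedAddCommGroup V₁] [NormedSpace ℝ V₁] [FiniteDimensional ℝ V₁]
    {V₂ : Type*} [NormedAddCommGroup V₂] [NormedSpace ℝ V₂] [FiniteDimensional ℝ V₂]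
    {ι₁ ι₂ ι : Type*} [Fintype ι₁] [DecidableEq ι₁] [Fintype ι₂] [DecidableEq ι₂]
    [Fintype ι] [DecidableEq ι]
    (b₁ : Module.Basis ι₁ ℝ V₁) (b₂ : Module.Basis ι₂ ℝ V₂) (b : Module.Basis ι ℝ (V₁ × V₂))
    (Φ₁ : LieProlongation.LieRep I G V₁) (Φ₂ : LieProlongation.LieRep I G V₂) :
    (LinearMap.GeneralLinearGroup.congrLinearEquiv
        (LieProlongation.tangentProdEquiv (V₁ := V₁) (V₂ := V₂))).toMonoidHom.comp
      (LieProlongation.prolongation b (LieProlongation.LieRep.directSum Φ₁ Φ₂)) =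
    LieProlongation.directSum (LieProlongation.prolongation b₁ Φ₁) (LieProlongation.prolongation b₂ Φ₂) := by
  open LieProlongation in
  refine MonoidHom.ext fun X => Units.ext (LinearMap.ext fun q => ?_)
  obtain ⟨W, rfl⟩ := (tangentProdEquiv (V₁ := V₁) (V₂ := V₂)).surjective q
  simpa [directSum] using tangentProdEquiv_prolongation b₁ b₂ b Φ₁ Φ₂ X W
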